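/- All graphs are finite, simple and undirected. A clique of a graph $G$ is a set of vertices that induces a complete subgraph. A triangle clique cover of $G$ is a set $\mathcal C$ of cliques of $G$ such that every clique of $G$ with exactly three vertices is contained in some $Q\in\mathcal C$; the triangle clique cover number $\theta_{\triangle}(G)$ is the minimum of $|\mathcal C|$ over all triangle clique covers $\mathcal C$ of $G$. For $n\ge 0$ let $T(n,3)$ be the Turán graph, that is, the complete $3$-partite graph on $n$ vertices whose part sizes differ by at most $1$ (parts may be empty), and let $k_3(H)$ be the number of triangles of a graph $H$. **Theorem.** For every graph $G$ on $n$ vertices, \[ \theta_{\triangle}(G)\le k_3(T(n,3)). \] If $n\ne 2$ and $\theta_{\triangle}(G)=k_3(T(n,3))$, then $G\cong T(n,3)$. Moreover $\theta_{\triangle}(T(n,3))=k_3(T(n,3))$, so the bound is attained by $T(n,3)$. -/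

import Mathlib

namespace SimpleGraph

/-- A set `C` of cliques of `G` is a `K_t` clique cover of `G` if every clique of `G` on exactly `t`
vertices is contained in some member of `C`. -/
def IsKtCliqueCover {V : Type*} (G : SimpleGraph V) (t : ℕ) (C : Finset (Finset V)) : Prop :=
  (∀ Q ∈ C, G.IsClique (Q : Set V)) ∧
    ∀ S : Finset V, G.IsNClique t S → ∃ Q ∈ C, S ⊆ Q

/-- A finite graph has a `K_t` clique cover, so the minimum below is over a nonempty set. -/
theorem exists_isKtCliqueCover {V : Type*} [Fintype V] (G : SimpleGraph V) (t : ℕ) :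
    ∃ C : Finset (Finset V), G.IsKtCliqueCover t C := by
  classical
  refine ⟨Finset.univ.filter fun Q : Finset V => G.IsClique (Q : Set V), ?_, ?_⟩
  · intro Q hQ
    exact (Finset.mem_filter.mp hQ).2
  · intro S hS
    exact ⟨S, Finset.mem_filter.mpr ⟨Finset.mem_univ _, hS.isClique⟩, subset_rfl⟩

/-- The `K_t` clique cover number of a finite graph: the minimum number of cliques in a
`K_t` clique cover. -/
noncomputable def ktCliqueCoverNumber {V : Type*} [Fintype V] (G : SimpleGraph V) (t : ℕ) : ℕ :=
  sInf {k : ℕ | ∃ C : Finset (Finset V), G.IsKtCliqueCover t C ∧ C.card = k}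

/-- The triangle clique cover number: the case `t = 3`. -/
noncomputable def triangleCliqueCoverNumber {V : Type*} [Fintype V] (G : SimpleGraph V) : ℕ :=
  G.ktCliqueCoverNumber 3

end SimpleGraph

open Finset

namespace SimpleGraph

/-! Induct on the number `s` of vertices by deleting a vertex `v` of minimum degree `d`. Triangles
through `v` are edges of `N(v)`, so it suffices to cover those edges by `⌊s/3⌋⌊(s+1)/3⌋` cliques,
the increment of the Turán count.

If `d ≤ ⌊s/3⌋ + ⌊(s+1)/3⌋`, the Erdős–Goodman–Pósa bound `⌊d²/4⌋` is enough. Otherwise put `a = s -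
d`: every vertex has fewer than `a` non-neighbours, so greedy colouring of the complement splits
`N(v)` into `a` cliques. Joining vertices to whole classes gives a cheap edge cover
(`exists_coversEdges_of_coloring`, `cliquePartition_bound`).

Under equality every increment is tight. The strict form of Erdős–Goodman–Pósa then excludes `K₄`,
the minimum degree is that of the Turán graph, and so is the number of edges; Turán's theorem
identifies the graph. Conversely, in a `K₄`-free graph no clique contains two triangles, so the
Turán graph attains the bound. -/

theorem exists_card_le_mul_card_fiber {α : Type*} {S : Finset α} {a : ℕ} {c : α → ℕ} (ha : 0 < a)
    (hc : ∀ x ∈ S, c x < a) : ∃ m < a, S.card ≤ a * (S.filter fun x => c x = m).card := by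
  obtain ⟨m, hm, hmax⟩ := exists_max_image (range a) (fun i => (S.filter fun x => c x = i).card)
    ⟨0, mem_range.2 ha⟩
  refine ⟨m, mem_range.1 hm, ?_⟩
  rw [card_eq_sum_card_fiberwise (f := c) (t := range a) fun x hx => mem_range.2 (hc x hx)]
  simpa using sum_le_card_nsmul (range a) _ _ hmax

theorem isClique_pair_coe {V : Type*} [DecidableEq V] {G : SimpleGraph V} {x y : V} (h : G.Adj x y) :
    G.IsClique (({x, y} : Finset V) : Set V) := by
  rw [coe_pair]
  exact isClique_pair.2 fun _ => h

/-! ### Covers relative to a vertex set; deleting a vertex -/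

variable {V : Type*} [DecidableEq V] (G : SimpleGraph V) [DecidableRel G.Adj]

/-- `C` is a family of cliques covering all triangles of `G` with vertices in `S`. -/
def CoversTriangles (S : Finset V) (C : Finset (Finset V)) : Prop :=
  (∀ Q ∈ C, G.IsClique (Q : Set V)) ∧
    ∀ T ⊆ S, G.IsNClique 3 T → ∃ Q ∈ C, T ⊆ Q

/-- `C` is a family of cliques covering all edges of `G` with both ends in `S`. -/
def CoversEdges (S : Finset V) (C : Finset (Finset V)) : Prop :=
  (∀ Q ∈ C, G.IsClique (Q : Set V)) ∧
    ∀ x ∈ S, ∀ y ∈ S, G.Adj x y → ∃ Q ∈ C, x ∈ Q ∧ y ∈ Q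

/-- The neighbours of `x` in `S`. -/
def nbrsIn (S : Finset V) (x : V) : Finset V := S.filter (G.Adj x)

/-- The number of triangles of the Turán graph `T(n, 3)`. -/
def turanTriangles (n : ℕ) : ℕ := n / 3 * ((n + 1) / 3) * ((n + 2) / 3)

/-- The number of edges of the Turán graph `T(n, 3)`. -/
def turanEdges (n : ℕ) : ℕ :=
  n / 3 * ((n + 1) / 3) + (n + 1) / 3 * ((n + 2) / 3) + (n + 2) / 3 * (n / 3)

variable {G}

/-- Every clique built below has this form. The filter is needed because `Q` may contain
non-neighbours of `v`. -/
theorem isClique_insert_filter {Q : Finset V} (hQ : G.IsClique (Q : Set V)) (v : V) :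
    G.IsClique (insert v (Q.filter (G.Adj v)) : Finset V) := by
  intro x hx y hy hxy
  simp only [coe_insert, coe_filter, Set.mem_insert_iff, Set.mem_ofPred_eq] at hx hy
  rcases hx with rfl | hx <;> rcases hy with rfl | hy
  · exact absurd rfl hxy
  · exact hy.2
  · exact hx.2.symm
  · exact hQ hx.1 hy.1 hxy

/-- Triangles through `v` correspond to edges in the neighbourhood of `v`. -/
theorem CoversTriangles.exists_of_erase {S : Finset V} {v : V}
    {C₁ C₂ : Finset (Finset V)} (h₁ : G.CoversTriangles (S.erase v) C₁)
    (h₂ : G.CoversEdges (G.nbrsIn S v) C₂) :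
    ∃ C, G.CoversTriangles S C ∧ C.card ≤ C₁.card + C₂.card := by
  refine ⟨C₁ ∪ C₂.image fun Q => insert v (Q.filter (G.Adj v)), ⟨?_, ?_⟩,
    (card_union_le _ _).trans (Nat.add_le_add_left card_image_le _)⟩
  · intro Q hQ
    rcases mem_union.1 hQ with hQ | hQ
    · exact h₁.1 Q hQ
    · obtain ⟨R, hR, rfl⟩ := mem_image.1 hQ
      exact isClique_insert_filter (h₂.1 R hR) v
  · intro T hTS hT
    by_cases hv : v ∈ T
    · obtain ⟨x, y, hxy, hE⟩ := card_eq_two.1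
        (show (T.erase v).card = 2 by rw [card_erase_of_mem hv, hT.card_eq])
      have hx : x ∈ T.erase v := by rw [hE]; simp
      have hy : y ∈ T.erase v := by rw [hE]; simp
      rw [mem_erase] at hx hy
      have hvx : G.Adj v x := hT.isClique hv hx.2 hx.1.symm
      have hvy : G.Adj v y := hT.isClique hv hy.2 hy.1.symm
      obtain ⟨Q, hQ, hxQ, hyQ⟩ := h₂.2 x (mem_filter.2 ⟨hTS hx.2, hvx⟩) y
        (mem_filter.2 ⟨hTS hy.2, hvy⟩) (hT.isClique hx.2 hy.2 hxy)
      refine ⟨_, mem_union_right _ (mem_image_of_mem _ hQ), ?_⟩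
      rw [← insert_erase hv, hE]
      apply insert_subset_insert
      intro z hz
      rcases mem_insert.1 hz with rfl | hz
      · exact mem_filter.2 ⟨hxQ, hvx⟩
      · rw [mem_singleton.1 hz]
        exact mem_filter.2 ⟨hyQ, hvy⟩
    · obtain ⟨Q, hQ, h⟩ := h₁.2 T (fun x hx => mem_erase.2 ⟨fun h => hv (h ▸ hx), hTS hx⟩) hT
      exact ⟨Q, mem_union_left _ hQ, h⟩

/-! ### Erdős–Goodman–Pósa edge covers -/

/-- Covering the edges that meet `{x, y}` and the rest of `S` by one clique for each vertex. -/
theorem CoversEdges.exists_of_adj {S : Finset V} {x y : V} (hx : x ∈ S) (hy : y ∈ S)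
    (hxy : G.Adj x y) {C : Finset (Finset V)}
    (hC : G.CoversEdges ((S.erase x).erase y) C) :
    ∃ D : Finset (Finset V), D.card ≤ C.card + (S.card - 2) ∧
      (∀ Q ∈ D, G.IsClique (Q : Set V)) ∧
      (∀ z ∈ S, ∀ w ∈ S, G.Adj z w → (∃ Q ∈ D, z ∈ Q ∧ w ∈ Q) ∨ s(z, w) = s(x, y)) ∧
      ∀ z ∈ S, G.Adj z x → G.Adj z y → ∃ Q ∈ D, x ∈ Q ∧ y ∈ Q := by
  set R := (S.erase x).erase y with hR
  have hRmem : ∀ z, z ∈ R ↔ z ≠ y ∧ z ≠ x ∧ z ∈ S := by simp [hR]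
  have hcard : R.card = S.card - 2 := by
    rw [hR, card_erase_of_mem (mem_erase.2 ⟨hxy.ne.symm, hy⟩), card_erase_of_mem hx]
    omega
  -- If `z` is adjacent to both `x` and `y`, the clique `f z` also covers the edge `xy`; this is the
  -- clique saved when a triangle is present.
  let f : V → Finset V := fun z => insert z (({x, y} : Finset V).filter (G.Adj z))
  have key : ∀ z ∈ R, ∀ w, w = x ∨ w = y → G.Adj z w →
      ∃ Q ∈ C ∪ R.image f, z ∈ Q ∧ w ∈ Q := by
    intro z hz w hw hzw
    refine ⟨f z, mem_union_right _ (mem_image_of_mem _ hz), mem_insert_self _ _, ?_⟩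
    exact mem_insert_of_mem (mem_filter.2 ⟨by simpa using hw, hzw⟩)
  refine ⟨C ∪ R.image f, ?_, ?_, ?_, ?_⟩
  · exact (card_union_le _ _).trans (Nat.add_le_add_left (card_image_le.trans hcard.le) _)
  · intro Q hQ
    rcases mem_union.1 hQ with hQ | hQ
    · exact hC.1 Q hQ
    · obtain ⟨z, -, rfl⟩ := mem_image.1 hQ
      exact isClique_insert_filter (isClique_pair_coe hxy) z
  · intro z hz w hw hzw
    by_cases hzR : z ∈ R
    · by_cases hwR : w ∈ R
      · obtain ⟨Q, hQ, h⟩ := hC.2 z hzR w hwR hzw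
        exact Or.inl ⟨Q, mem_union_left _ hQ, h⟩
      · refine Or.inl (key z hzR w ?_ hzw)
        rw [hRmem] at hwR
        tauto
    · have hz' : z = x ∨ z = y := by rw [hRmem] at hzR; tauto
      by_cases hwR : w ∈ R
      · obtain ⟨Q, hQ, h₁, h₂⟩ := key w hwR z hz' hzw.symm
        exact Or.inl ⟨Q, hQ, h₂, h₁⟩
      · have hw' : w = x ∨ w = y := by rw [hRmem] at hwR; tauto
        right
        rcases hz' with rfl | rfl <;> rcases hw' with rfl | rfl
        · exact absurd rfl hzw.ne
        · rfl
        · exact Sym2.eq_swap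
        · exact absurd rfl hzw.ne
  · intro z hz hzx hzy
    refine ⟨f z, mem_union_right _ (mem_image_of_mem _ ((hRmem z).2 ⟨hzy.ne, hzx.ne, hz⟩)), ?_, ?_⟩
    · exact mem_insert_of_mem (mem_filter.2 ⟨by simp, hzx⟩)
    · exact mem_insert_of_mem (mem_filter.2 ⟨by simp, hzy⟩)

theorem sq_div_four_sub_two {s : ℕ} (hs : 2 ≤ s) : (s - 2) ^ 2 / 4 + (s - 2) + 1 = s ^ 2 / 4 := by
  obtain ⟨m, rfl⟩ := Nat.exists_eq_add_of_le hs
  have : (2 + m) ^ 2 = m ^ 2 + (m + 1) * 4 := by ring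
  rw [this, Nat.add_mul_div_right _ _ (by norm_num), Nat.add_sub_cancel_left]
  omega

/-- The Erdős–Goodman–Pósa theorem, with strict inequality in the presence of a triangle. -/
theorem exists_coversEdges_card_le (S : Finset V) :
    ∃ C, G.CoversEdges S C ∧ C.card ≤ S.card ^ 2 / 4 ∧
      ((∃ T ⊆ S, G.IsNClique 3 T) → C.card + 1 ≤ S.card ^ 2 / 4) := by
  induction hs : S.card using Nat.strong_induction_on generalizing S with
  | _ s ih =>
  have step : ∀ x ∈ S, ∀ y ∈ S, G.Adj x y → 2 ≤ s ∧ ∃ D : Finset (Finset V),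
      D.card + 1 ≤ s ^ 2 / 4 ∧
      (∀ Q ∈ D, G.IsClique (Q : Set V)) ∧
      (∀ z ∈ S, ∀ w ∈ S, G.Adj z w → (∃ Q ∈ D, z ∈ Q ∧ w ∈ Q) ∨ s(z, w) = s(x, y)) ∧
      ∀ z ∈ S, G.Adj z x → G.Adj z y → ∃ Q ∈ D, x ∈ Q ∧ y ∈ Q := by
    intro x hx y hy hxy
    have hy' : y ∈ S.erase x := mem_erase.2 ⟨hxy.ne.symm, hy⟩
    have h1 := card_erase_add_one hx
    have h2 := card_erase_add_one hy'
    have hs2 : 2 ≤ s := by omega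
    refine ⟨hs2, ?_⟩
    obtain ⟨C, hC, hCc, -⟩ := ih (s - 2) (by omega) ((S.erase x).erase y) (by omega)
    obtain ⟨D, hD, hD'⟩ := hC.exists_of_adj hx hy hxy
    refine ⟨D, ?_, hD'⟩
    rw [← sq_div_four_sub_two hs2]
    omega
  by_cases hT : ∃ T ⊆ S, G.IsNClique 3 T
  · obtain ⟨T, hTS, hT⟩ := hT
    obtain ⟨x, y, z, hxy, hxz, hyz, rfl⟩ := is3Clique_iff.1 hT
    have hx : x ∈ S := hTS (by simp)
    have hy : y ∈ S := hTS (by simp)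
    have hz : z ∈ S := hTS (by simp)
    obtain ⟨-, D, hDc, hD, hcov, hcom⟩ := step x hx y hy hxy
    refine ⟨D, ⟨hD, ?_⟩, by omega, fun _ => hDc⟩
    intro u hu w hw huw
    rcases hcov u hu w hw huw with h | h
    · exact h
    · obtain ⟨Q, hQ, h1, h2⟩ := hcom z hz hxz.symm hyz.symm
      rcases Sym2.eq_iff.1 h with ⟨rfl, rfl⟩ | ⟨rfl, rfl⟩
      · exact ⟨Q, hQ, h1, h2⟩
      · exact ⟨Q, hQ, h2, h1⟩
  · by_cases hE : ∃ x ∈ S, ∃ y ∈ S, G.Adj x y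
    · obtain ⟨x, hx, y, hy, hxy⟩ := hE
      obtain ⟨-, D, hDc, hD, hcov, -⟩ := step x hx y hy hxy
      refine ⟨insert {x, y} D, ⟨?_, ?_⟩, (card_insert_le _ _).trans hDc, fun h => absurd h hT⟩
      · intro Q hQ
        rcases mem_insert.1 hQ with rfl | hQ
        · exact isClique_pair_coe hxy
        · exact hD Q hQ
      · intro u hu w hw huw
        rcases hcov u hu w hw huw with ⟨Q, hQ, h⟩ | h
        · exact ⟨Q, mem_insert_of_mem hQ, h⟩
        · refine ⟨{x, y}, mem_insert_self _ _, ?_⟩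
          rcases Sym2.eq_iff.1 h with ⟨rfl, rfl⟩ | ⟨rfl, rfl⟩ <;> simp
    · exact ⟨∅, ⟨by simp, fun x hx y hy h => absurd ⟨x, hx, y, hy, h⟩ hE⟩, by simp,
        fun h => absurd h hT⟩

/-! ### Edge covers from a partition into cliques -/

/-- Greedy colouring of the complement. -/
theorem exists_clique_coloring (S : Finset V) (a : ℕ)
    (h : ∀ x ∈ S, (S.filter fun y => y ≠ x ∧ ¬ G.Adj x y).card < a) :
    ∃ c : V → ℕ, (∀ x ∈ S, c x < a) ∧
      ∀ x ∈ S, ∀ y ∈ S, x ≠ y → c x = c y → G.Adj x y := by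
  induction S using Finset.induction_on with
  | empty => exact ⟨fun _ => 0, by simp, by simp⟩
  | insert v S hv ih =>
    obtain ⟨c, hc, hadj⟩ := ih fun x hx =>
      (card_le_card (filter_subset_filter _ (subset_insert v S))).trans_lt
        (h x (mem_insert_of_mem hx))
    have hlt : ((S.filter fun y => ¬ G.Adj v y).image c).card < (range a).card := by
      rw [card_range]
      refine card_image_le.trans_lt (lt_of_le_of_lt (card_le_card ?_) (h v (mem_insert_self v S)))
      intro y hy
      rw [mem_filter] at hy ⊢
      exact ⟨mem_insert_of_mem hy.1, fun e => hv (e ▸ hy.1), hy.2⟩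
    obtain ⟨i, hi, hi'⟩ := exists_mem_notMem_of_card_lt_card hlt
    have hvi : ∀ y ∈ S, c y = i → G.Adj v y := by
      intro y hy hyi
      by_contra hn
      exact hi' (mem_image.2 ⟨y, mem_filter.2 ⟨hy, hn⟩, hyi⟩)
    have hne : ∀ y ∈ S, y ≠ v := fun y hy e => hv (e ▸ hy)
    refine ⟨Function.update c v i, ?_, ?_⟩
    · intro x hx
      rcases mem_insert.1 hx with rfl | hx
      · simpa using hi
      · rw [Function.update_of_ne (hne x hx)]
        exact hc x hx
    · intro x hx y hy hxy
      rcases mem_insert.1 hx with rfl | hxS <;> rcases mem_insert.1 hy with rfl | hyS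
      · exact absurd rfl hxy
      · rw [Function.update_self, Function.update_of_ne (hne y hyS)]
        exact fun e => hvi y hyS e.symm
      · rw [Function.update_self, Function.update_of_ne (hne x hxS)]
        exact fun e => (hvi x hxS e).symm
      · rw [Function.update_of_ne (hne x hxS), Function.update_of_ne (hne y hyS)]
        exact hadj x hxS y hyS hxy

/-- An edge cover built from a partition into `a` cliques with a distinguished class `m`: each vertex
outside that class is joined to it and to the classes that come after (or before) its own. -/
theorem exists_coversEdges_of_coloring {S : Finset V} {a : ℕ} {c : V → ℕ}
    (hc : ∀ x ∈ S, c x < a) (hadj : ∀ x ∈ S, ∀ y ∈ S, x ≠ y → c x = c y → G.Adj x y)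
    {m : ℕ} (hm : m < a) :
    ∃ C, G.CoversEdges S C ∧ 2 * C.card ≤ a * (S.filter fun x => c x ≠ m).card + 2 * a := by
  let K : ℕ → Finset V := fun i => S.filter fun x => c x = i
  have hK : ∀ i, G.IsClique (K i : Set V) := by
    intro i x hx y hy hxy
    have hx := mem_filter.1 (mem_coe.1 hx)
    have hy := mem_filter.1 (mem_coe.1 hy)
    exact hadj x hx.1 y hy.1 hxy (hx.2.trans hy.2.symm)
  let U := S.filter fun x => c x ≠ m
  let f : V × ℕ → Finset V := fun p => insert p.1 ((K p.2).filter (G.Adj p.1))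
  -- Three kinds of cliques: the classes, each outside vertex with its neighbours in class `m`, and
  -- the pairs in `P` for edges between two other classes.
  have build : ∀ P : Finset (V × ℕ),
      (∀ x ∈ U, ∀ y ∈ U, c x ≠ c y → (x, c y) ∈ P ∨ (y, c x) ∈ P) →
      ∃ C, G.CoversEdges S C ∧ C.card ≤ a + U.card + P.card := by
    intro P hP
    refine ⟨(range a).image K ∪ U.image (fun x => f (x, m)) ∪ P.image f, ⟨?_, ?_⟩, ?_⟩
    · intro Q hQ
      simp only [mem_union, mem_image] at hQ
      rcases hQ with (⟨i, -, rfl⟩ | ⟨x, -, rfl⟩) | ⟨p, -, rfl⟩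
      · exact hK i
      · exact isClique_insert_filter (hK _) _
      · exact isClique_insert_filter (hK _) _
    · intro x hx y hy hxy
      have hf : ∀ u ∈ S, ∀ w, G.Adj w u → w ∈ f (w, c u) ∧ u ∈ f (w, c u) := fun u hu w hwu =>
        ⟨mem_insert_self _ _, mem_insert_of_mem (mem_filter.2 ⟨mem_filter.2 ⟨hu, rfl⟩, hwu⟩)⟩
      by_cases hxc : c x = c y
      · refine ⟨K (c x), ?_, mem_filter.2 ⟨hx, rfl⟩, mem_filter.2 ⟨hy, hxc.symm⟩⟩
        exact mem_union_left _ (mem_union_left _ (mem_image_of_mem _ (mem_range.2 (hc x hx))))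
      by_cases hxm : c x = m
      · have hyU : y ∈ U := mem_filter.2 ⟨hy, fun h => hxc (hxm.trans h.symm)⟩
        refine ⟨f (y, m), mem_union_left _ (mem_union_right _ (mem_image.2 ⟨y, hyU, rfl⟩)), ?_⟩
        have := hf x hx y hxy.symm
        rw [hxm] at this
        exact this.symm
      have hxU : x ∈ U := mem_filter.2 ⟨hx, hxm⟩
      by_cases hym : c y = m
      · refine ⟨f (x, m), mem_union_left _ (mem_union_right _ (mem_image.2 ⟨x, hxU, rfl⟩)), ?_⟩
        have := hf y hy x hxy
        rwa [hym] at this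
      have hyU : y ∈ U := mem_filter.2 ⟨hy, hym⟩
      rcases hP x hxU y hyU hxc with h | h
      · exact ⟨_, mem_union_right _ (mem_image_of_mem _ h), hf y hy x hxy⟩
      · exact ⟨_, mem_union_right _ (mem_image_of_mem _ h), (hf x hx y hxy.symm).symm⟩
    · refine (card_union_le _ _).trans (Nat.add_le_add ?_ card_image_le)
      refine (card_union_le _ _).trans (Nat.add_le_add ?_ card_image_le)
      exact card_image_le.trans_eq (card_range a)
  let P₁ := (U ×ˢ (range a).erase m).filter fun p => c p.1 < p.2
  let P₂ := (U ×ˢ (range a).erase m).filter fun p => p.2 < c p.1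
  have hcU : ∀ x ∈ U, c x ∈ (range a).erase m := fun x hx =>
    mem_erase.2 ⟨(mem_filter.1 hx).2, mem_range.2 (hc x (mem_filter.1 hx).1)⟩
  obtain ⟨C₁, hC₁, hcard₁⟩ := build P₁ (by
    intro x hx y hy hxy
    rcases lt_or_gt_of_ne hxy with h | h
    · exact Or.inl (mem_filter.2 ⟨mem_product.2 ⟨hx, hcU y hy⟩, h⟩)
    · exact Or.inr (mem_filter.2 ⟨mem_product.2 ⟨hy, hcU x hx⟩, h⟩))
  obtain ⟨C₂, hC₂, hcard₂⟩ := build P₂ (by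
    intro x hx y hy hxy
    rcases lt_or_gt_of_ne hxy with h | h
    · exact Or.inr (mem_filter.2 ⟨mem_product.2 ⟨hy, hcU x hx⟩, h⟩)
    · exact Or.inl (mem_filter.2 ⟨mem_product.2 ⟨hx, hcU y hy⟩, h⟩))
  -- `P₁`, `P₂` and the diagonal pairs `(x, c x)` are disjoint in a product of size `|U|(a - 1)`, so
  -- the smaller of `P₁`, `P₂` has at most `|U|(a - 2)/2` elements.
  have hP : P₁.card + P₂.card + U.card ≤ U.card * (a - 1) := by
    have hd : ((U ×ˢ (range a).erase m).filter fun p => c p.1 = p.2).card = U.card := by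
      refine (card_bij (fun x _ => (x, c x)) ?_ ?_ ?_).symm
      · exact fun x hx => mem_filter.2 ⟨mem_product.2 ⟨hx, hcU x hx⟩, rfl⟩
      · exact fun x _ y _ h => (Prod.mk.inj h).1
      · rintro ⟨x, i⟩ h
        obtain ⟨h1, h2⟩ := mem_filter.1 h
        exact ⟨x, (mem_product.1 h1).1, Prod.ext rfl h2⟩
    have hE : ((range a).erase m).card = a - 1 := by
      rw [card_erase_of_mem (mem_range.2 hm), card_range]
    rw [← hE, ← card_product, ← hd, ← card_union_of_disjoint, ← card_union_of_disjoint]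
    · exact card_le_card (union_subset (union_subset (filter_subset _ _) (filter_subset _ _))
        (filter_subset _ _))
    · rw [Finset.disjoint_left]
      intro p hp hp'
      have h2 := (mem_filter.1 hp').2
      rcases mem_union.1 hp with h | h
      · exact (mem_filter.1 h).2.ne h2
      · exact (mem_filter.1 h).2.ne h2.symm
    · rw [Finset.disjoint_left]
      exact fun p hp hp' => lt_asymm (mem_filter.1 hp).2 (mem_filter.1 hp').2
  have hUa : U.card * (a - 1) + U.card = a * U.card := by
    obtain ⟨b, rfl⟩ : ∃ b, a = b + 1 := ⟨a - 1, by omega⟩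
    rw [Nat.add_sub_cancel]
    ring
  change ∃ C, G.CoversEdges S C ∧ 2 * C.card ≤ a * U.card + 2 * a
  rcases le_total P₁.card P₂.card with h | h
  · exact ⟨C₁, hC₁, by omega⟩
  · exact ⟨C₂, hC₂, by omega⟩

/-! ### Arithmetic of the Turán numbers -/

theorem turanTriangles_succ (n : ℕ) :
    turanTriangles (n + 1) = turanTriangles n + (n + 1) / 3 * ((n + 2) / 3) := by
  unfold turanTriangles
  rw [show (n + 1 + 2) / 3 = n / 3 + 1 by omega]
  ring_nf

theorem turanEdges_succ (n : ℕ) :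
    turanEdges (n + 1) = turanEdges n + ((n + 1) / 3 + (n + 2) / 3) := by
  unfold turanEdges
  rw [show (n + 1 + 2) / 3 = n / 3 + 1 by omega]
  ring_nf

theorem sq_div_four_eq (n : ℕ) :
    (n / 3 + (n + 1) / 3) ^ 2 / 4 = n / 3 * ((n + 1) / 3) := by
  obtain h | h : (n + 1) / 3 = n / 3 ∨ (n + 1) / 3 = n / 3 + 1 := by omega
  all_goals
    rw [h]
    generalize n / 3 = k
  · rw [show (k + k) ^ 2 = k * k * 4 by ring, Nat.mul_div_cancel _ (by norm_num)]
  · rw [show (k + (k + 1)) ^ 2 = 1 + k * (k + 1) * 4 by ring,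
      Nat.add_mul_div_right _ _ (by norm_num)]
    simp

/-- The squares differ by at least 3, with equality only for `d = 1`, `e = 2`. The pair `0, 1` shows
why `2 ≤ e` is required. -/
theorem sq_div_four_lt {d e : ℕ} (hde : d < e) (he : 2 ≤ e) : d ^ 2 / 4 < e ^ 2 / 4 := by
  have : d ^ 2 + 1 * 4 ≤ e ^ 2 + 1 := by nlinarith
  rcases Nat.eq_or_lt_of_le this with h | h
  · obtain ⟨f, rfl⟩ := Nat.exists_eq_add_of_lt hde
    have : f = 0 := by nlinarith
    subst this
    have : d = 1 := by nlinarith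
    subst this
    norm_num
  · calc d ^ 2 / 4 < d ^ 2 / 4 + 1 := Nat.lt_succ_self _
      _ = (d ^ 2 + 1 * 4) / 4 := (Nat.add_mul_div_right _ _ (by norm_num)).symm
      _ ≤ e ^ 2 / 4 := Nat.div_le_div_right (by omega)

/-- The size of the edge cover from a partition into `a` cliques is within the Turán increment. -/
theorem cliquePartition_bound {s a q : ℕ} (ha : 0 < a) (has : 3 * a + 1 ≤ s)
    (hq : s - a ≤ a * q) (hqs : q ≤ s - a) :
    a * (s - a - q) + 2 * a ≤ 2 * (s / 3 * ((s + 1) / 3)) := by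
  obtain ⟨u, rfl⟩ : ∃ u, s = 3 * a + 1 + u := ⟨s - (3 * a + 1), by omega⟩
  have hsub : 3 * a + 1 + u - a = 2 * a + 1 + u := by omega
  rw [hsub] at hq hqs ⊢
  obtain ⟨w, hw⟩ := Nat.exists_eq_add_of_le hqs
  rw [hw, Nat.add_sub_cancel_left]
  -- Averaging alone is too weak when `s = 3a + 1`; there `q ≥ 3` gives `w ≤ 2a - 2`, which is
  -- exactly enough.
  have hq3 : 3 ≤ q := by
    by_contra h
    have : a * q ≤ a * 2 := Nat.mul_le_mul_left _ (by omega)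
    omega
  have haw : a * w + (2 * a + 1 + u) ≤ a * (2 * a + 1 + u) := by
    rw [hw, mul_add]; rw [hw] at hq; omega
  obtain ⟨v, hv⟩ : ∃ v, u = 3 * v ∨ u = 3 * v + 1 ∨ u = 3 * v + 2 := ⟨u / 3, by omega⟩
  rcases hv with rfl | rfl | rfl
  · rw [show (3 * a + 1 + 3 * v) / 3 = a + v by omega,
      show (3 * a + 1 + 3 * v + 1) / 3 = a + v by omega]
    rcases Nat.eq_zero_or_pos v with rfl | hv
    · have : w ≤ 2 * a - 2 := by omega
      obtain ⟨b, rfl⟩ : ∃ b, a = b + 1 := ⟨a - 1, by omega⟩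
      have : w ≤ 2 * b := by omega
      nlinarith
    · nlinarith
  · rw [show (3 * a + 1 + (3 * v + 1)) / 3 = a + v by omega,
      show (3 * a + 1 + (3 * v + 1) + 1) / 3 = a + v + 1 by omega]
    nlinarith
  · rw [show (3 * a + 1 + (3 * v + 2)) / 3 = a + v + 1 by omega,
      show (3 * a + 1 + (3 * v + 2) + 1) / 3 = a + v + 1 by omega]
    nlinarith

/-! ### Degrees and the upper bound -/

theorem card_nbrsIn_lt {V : Type*} {G : SimpleGraph V} [DecidableRel G.Adj] {S : Finset V} {x : V} (hx : x ∈ S) : (G.nbrsIn S x).card < S.card :=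
  card_lt_card ⟨filter_subset _ _, fun h => G.irrefl (mem_filter.1 (h hx)).2⟩

theorem isNClique_erase_of_mem {V : Type*} [DecidableEq V] {G : SimpleGraph V} {k : ℕ} {T : Finset V} {v : V} (hT : G.IsNClique (k + 1) T)
    (hv : v ∈ T) : G.IsNClique k (T.erase v) :=
  ⟨hT.isClique.subset (by simp), by rw [card_erase_of_mem hv, hT.card_eq]; rfl⟩

theorem sum_nbrsIn_erase {S : Finset V} {v : V} (hv : v ∈ S) :
    ∑ x ∈ S, (G.nbrsIn S x).card =
      ∑ x ∈ S.erase v, (G.nbrsIn (S.erase v) x).card + 2 * (G.nbrsIn S v).card := by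
  have h : ∀ x ∈ S.erase v, (G.nbrsIn S x).card =
      (G.nbrsIn (S.erase v) x).card + if G.Adj v x then 1 else 0 := by
    intro x hx
    unfold nbrsIn
    rw [filter_erase]
    split_ifs with h
    · exact (card_erase_add_one (mem_filter.2 ⟨hv, h.symm⟩)).symm
    · rw [erase_eq_of_notMem fun hm => h (mem_filter.1 hm).2.symm, add_zero]
  have h2 : ∑ x ∈ S.erase v, (if G.Adj v x then 1 else 0) = (G.nbrsIn S v).card := by
    rw [← card_filter, filter_erase, erase_eq_of_notMem (by simp)]
    rfl
  rw [← add_sum_erase _ _ hv, sum_congr rfl h, sum_add_distrib, h2]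
  ring

theorem card_nonNbrs {S : Finset V} {x : V} (hx : x ∈ S) :
    (S.filter fun y => y ≠ x ∧ ¬ G.Adj x y).card + (G.nbrsIn S x).card + 1 = S.card := by
  have h : S.erase x = (S.filter fun y => y ≠ x ∧ ¬ G.Adj x y) ∪ G.nbrsIn S x := by
    ext y
    simp only [nbrsIn, mem_erase, mem_union, mem_filter]
    constructor
    · tauto
    · rintro (h | h)
      · exact ⟨h.2.1, h.1⟩
      · exact ⟨h.2.ne.symm, h.1⟩
  rw [← card_erase_add_one hx, h, card_union_of_disjoint]
  rw [Finset.disjoint_left]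
  exact fun y hy hy' => (mem_filter.1 hy).2.2 (mem_filter.1 hy').2

/-- If all vertices have large degree, the neighbourhood of a vertex of minimum degree has a small
edge cover. -/
theorem exists_coversEdges_nbrsIn {S : Finset V} {v : V} (hv : v ∈ S)
    (hmin : ∀ x ∈ S, (G.nbrsIn S v).card ≤ (G.nbrsIn S x).card)
    (hd : S.card / 3 + (S.card + 1) / 3 < (G.nbrsIn S v).card) :
    ∃ C, G.CoversEdges (G.nbrsIn S v) C ∧ C.card ≤ S.card / 3 * ((S.card + 1) / 3) := by
  set N := G.nbrsIn S v with hN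
  have hNS : N ⊆ S := filter_subset _ _
  have hlt : N.card < S.card := card_nbrsIn_lt hv
  obtain ⟨a, ha⟩ : ∃ a, S.card = N.card + a := Nat.exists_eq_add_of_le hlt.le
  have ha0 : 0 < a := by omega
  obtain ⟨c, hc, hadj⟩ := exists_clique_coloring (G := G) N a (by
    intro x hx
    have h1 := card_nonNbrs (G := G) (hNS hx)
    have h2 := hmin x (hNS hx)
    have h3 : (N.filter fun y => y ≠ x ∧ ¬ G.Adj x y).card ≤
      (S.filter fun y => y ≠ x ∧ ¬ G.Adj x y).card := card_le_card (filter_subset_filter _ hNS)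
    omega)
  obtain ⟨m, hm, hcard⟩ := exists_card_le_mul_card_fiber ha0 hc
  obtain ⟨C, hC, hCc⟩ := exists_coversEdges_of_coloring hc hadj hm
  refine ⟨C, hC, ?_⟩
  have hsplit : (N.filter fun x => c x = m).card + (N.filter fun x => c x ≠ m).card = N.card :=
    card_filter_add_card_filter_not _
  have hb := cliquePartition_bound (s := S.card) (a := a)
    (q := (N.filter fun x => c x = m).card) ha0 (by omega) (by omega) (by omega)
  rw [show S.card - a - (N.filter fun x => c x = m).card = (N.filter fun x => c x ≠ m).card by
    omega] at hb
  omega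

theorem two_mul_turanEdges_le (n : ℕ) : 3 * (2 * turanEdges n) ≤ 2 * n ^ 2 := by
  obtain ⟨k, rfl | rfl | rfl⟩ : ∃ k, n = 3 * k ∨ n = 3 * k + 1 ∨ n = 3 * k + 2 :=
    ⟨n / 3, by omega⟩
  · unfold turanEdges
    rw [show 3 * k / 3 = k by omega, show (3 * k + 1) / 3 = k by omega,
      show (3 * k + 2) / 3 = k by omega]
    nlinarith
  · unfold turanEdges
    rw [show (3 * k + 1) / 3 = k by omega, show (3 * k + 1 + 1) / 3 = k by omega,
      show (3 * k + 1 + 2) / 3 = k + 1 by omega]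
    nlinarith
  · unfold turanEdges
    rw [show (3 * k + 2) / 3 = k by omega, show (3 * k + 2 + 1) / 3 = k + 1 by omega,
      show (3 * k + 2 + 2) / 3 = k + 1 by omega]
    nlinarith

/-- The neighbourhood of a vertex of minimum degree has an edge cover whose size is at most the
number of triangles of the Turán graph that meet a vertex of minimum degree. -/
theorem exists_coversEdges_of_min {S : Finset V} {v : V} (hv : v ∈ S)
    (hmin : ∀ x ∈ S, (G.nbrsIn S v).card ≤ (G.nbrsIn S x).card) :
    ∃ C, G.CoversEdges (G.nbrsIn S v) C ∧ C.card ≤ S.card / 3 * ((S.card + 1) / 3) := by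
  rcases lt_or_ge (S.card / 3 + (S.card + 1) / 3) (G.nbrsIn S v).card with hd | hd
  · exact exists_coversEdges_nbrsIn hv hmin hd
  · obtain ⟨C, hC, hCc, -⟩ := exists_coversEdges_card_le (G := G) (G.nbrsIn S v)
    refine ⟨C, hC, hCc.trans ?_⟩
    rw [← sq_div_four_eq]
    exact Nat.div_le_div_right (Nat.pow_le_pow_left hd 2)

/-- The upper bound for the triangle clique cover number. -/
theorem exists_coversTriangles_card_le (S : Finset V) :
    ∃ C, G.CoversTriangles S C ∧ C.card ≤ turanTriangles S.card := by
  induction hs : S.card generalizing S with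
  | zero =>
    rw [card_eq_zero] at hs
    subst hs
    refine ⟨∅, ⟨by simp, fun T hT h => ?_⟩, by simp⟩
    rw [subset_empty] at hT
    subst hT
    simpa using h.card_eq
  | succ n ih =>
    obtain ⟨v, hv, hmin⟩ := exists_min_image S (fun x => (G.nbrsIn S x).card)
      (card_pos.1 (by omega))
    obtain ⟨C₁, h₁, hc₁⟩ := ih (S.erase v) (by rw [card_erase_of_mem hv]; omega)
    obtain ⟨C₂, h₂, hc₂⟩ := exists_coversEdges_of_min hv hmin
    obtain ⟨C, hC, hCc⟩ := h₁.exists_of_erase h₂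
    refine ⟨C, hC, ?_⟩
    rw [hs] at hc₂
    change C₂.card ≤ (n + 1) / 3 * ((n + 2) / 3) at hc₂
    rw [turanTriangles_succ]
    omega

/-! ### The equality case -/

/-- In the extremal case no vertex of minimum degree has larger degree than in the Turán graph,
provided that deleting it leaves at most as many edges as in the Turán graph. -/
theorem card_nbrsIn_le_of_extremal {S : Finset V} {v : V} {n : ℕ} (hs : S.card = n + 1) (hv : v ∈ S)
    (hmin : ∀ x ∈ S, (G.nbrsIn S v).card ≤ (G.nbrsIn S x).card)
    (hext : ∀ C, G.CoversTriangles S C → turanTriangles (n + 1) ≤ C.card)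
    (hsum : n ≠ 2 → ∑ x ∈ S.erase v, (G.nbrsIn (S.erase v) x).card = 2 * turanEdges n) :
    (G.nbrsIn S v).card ≤ (n + 1) / 3 + (n + 2) / 3 := by
  by_contra! hd
  have hlt : (G.nbrsIn S v).card < S.card := card_nbrsIn_lt hv
  have hn : 3 ≤ n := by omega
  have h1 := sum_nbrsIn_erase (G := G) hv
  rw [hsum (by omega)] at h1
  have h2 : S.card * (G.nbrsIn S v).card ≤ ∑ x ∈ S, (G.nbrsIn S x).card := by
    simpa using card_nsmul_le_sum S _ _ hmin
  have h3 := two_mul_turanEdges_le n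
  rw [hs] at h2
  have h4 : 2 * n + 3 ≤ 3 * (G.nbrsIn S v).card := by omega
  -- The degree sum gives `(n - 1)d ≤ 2n²/3`, and with `3d ≥ 2n + 3` this forces `n ≤ 3`.
  have h5 : n = 3 := by
    by_contra hne
    obtain ⟨m, rfl⟩ := Nat.exists_eq_add_of_le (show 4 ≤ n by omega)
    nlinarith
  subst h5
  -- Now `S` is a `K₄`, covered by one clique, while `T(4, 3)` has two triangles.
  have hclique : G.IsClique (S : Set V) := by
    intro x hx y hy hxy
    by_contra hadj
    have h6 := card_nonNbrs (G := G) (mem_coe.1 hx)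
    have h7 := hmin x (mem_coe.1 hx)
    have h8 : 0 < (S.filter fun y => y ≠ x ∧ ¬ G.Adj x y).card :=
      card_pos.2 ⟨y, mem_filter.2 ⟨mem_coe.1 hy, hxy.symm, hadj⟩⟩
    omega
  have := hext {S} ⟨by simpa using hclique, fun T hT _ => ⟨S, mem_singleton_self _, hT⟩⟩
  simp [turanTriangles] at this

/-- A set of vertices with the largest possible triangle clique cover number induces a graph
without `K₄` that has as many edges as the Turán graph. -/
theorem cliqueFree_and_sum_nbrsIn_of_extremal (S : Finset V) (hs2 : S.card ≠ 2)
    (hext : ∀ C, G.CoversTriangles S C → turanTriangles S.card ≤ C.card) :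
    (∀ T ⊆ S, ¬ G.IsNClique 4 T) ∧
      ∑ x ∈ S, (G.nbrsIn S x).card = 2 * turanEdges S.card := by
  induction hs : S.card generalizing S with
  | zero =>
    rw [card_eq_zero] at hs
    subst hs
    refine ⟨fun T hT h => ?_, by simp [turanEdges]⟩
    rw [subset_empty] at hT
    subst hT
    simpa using h.card_eq
  | succ n ih =>
    obtain ⟨v, hv, hmin⟩ := exists_min_image S (fun x => (G.nbrsIn S x).card)
      (card_pos.1 (by omega))
    have hs' : (S.erase v).card = n := by rw [card_erase_of_mem hv]; omega
    rw [hs] at hext hs2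
    have ht := turanTriangles_succ n
    have hext' : ∀ C, G.CoversTriangles (S.erase v) C → turanTriangles n ≤ C.card := by
      intro C₁ h₁
      obtain ⟨C₂, h₂, hc₂⟩ := exists_coversEdges_of_min hv hmin
      obtain ⟨C, hC, hCc⟩ := h₁.exists_of_erase h₂
      have := hext C hC
      rw [hs] at hc₂
      change C₂.card ≤ (n + 1) / 3 * ((n + 2) / 3) at hc₂
      omega
    have hprev : n ≠ 2 → _ := fun hn =>
      ih (S.erase v) (by rwa [hs']) (by rwa [hs']) hs'
    have hle := card_nbrsIn_le_of_extremal hs hv hmin hext fun hn => (hprev hn).2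
    obtain ⟨C₁, h₁, hc₁⟩ := exists_coversTriangles_card_le (G := G) (S.erase v)
    obtain ⟨C₂, h₂, hc₂, hc₂'⟩ := exists_coversEdges_card_le (G := G) (G.nbrsIn S v)
    obtain ⟨C, hC, hCc⟩ := h₁.exists_of_erase h₂
    have hCe := hext C hC
    rw [hs'] at hc₁
    have hge : (n + 1) / 3 * ((n + 2) / 3) ≤ C₂.card := by omega
    have hsq : ((n + 1) / 3 + (n + 2) / 3) ^ 2 / 4 = (n + 1) / 3 * ((n + 2) / 3) :=
      sq_div_four_eq (n + 1)
    rw [← hsq] at hge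
    have hdeg : (G.nbrsIn S v).card = (n + 1) / 3 + (n + 2) / 3 := by
      by_contra hne
      have hlt := lt_of_le_of_ne hle hne
      -- The Turán degree is at least 2 except for `n = 0`, where `hlt` fails, and `n = 1`, the
      -- excluded two-vertex case.
      have := sq_div_four_lt hlt (by omega)
      omega
    have hfree : ∀ T ⊆ G.nbrsIn S v, ¬ G.IsNClique 3 T := by
      intro T hT h
      have := hc₂' ⟨T, hT, h⟩
      rw [hdeg] at this
      omega
    have hprev' : (∀ T ⊆ S.erase v, ¬ G.IsNClique 4 T) ∧
        ∑ x ∈ S.erase v, (G.nbrsIn (S.erase v) x).card = 2 * turanEdges n := by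
      -- Two remaining vertices escape the induction hypothesis, but minimum degree 2 on three
      -- vertices forces the edge between them.
      rcases eq_or_ne n 2 with rfl | hn
      · refine ⟨fun T hT h => ?_, ?_⟩
        · have := card_le_card hT
          rw [hs', h.card_eq] at this
          omega
        · have h1 := sum_nbrsIn_erase (G := G) hv
          have h2 : S.card * (G.nbrsIn S v).card ≤ ∑ x ∈ S, (G.nbrsIn S x).card := by
            simpa using card_nsmul_le_sum S _ _ hmin
          have h3 : ∑ x ∈ S.erase v, (G.nbrsIn (S.erase v) x).card ≤ (S.erase v).card * 1 := by
            simpa using sum_le_card_nsmul (S.erase v) (fun x => (G.nbrsIn (S.erase v) x).card) 1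
              fun x hx => by
                have := card_nbrsIn_lt (G := G) hx
                omega
          rw [hs, hdeg] at h2
          rw [hdeg] at h1
          rw [hs'] at h3
          simp only [turanEdges]
          omega
      · exact hprev hn
    refine ⟨fun T hT h => ?_, ?_⟩
    · by_cases hvT : v ∈ T
      · refine hfree (T.erase v) (fun x hx => ?_) (isNClique_erase_of_mem h hvT)
        rw [mem_erase] at hx
        exact mem_filter.2 ⟨hT hx.2, h.isClique hvT hx.2 hx.1.symm⟩
      · exact hprev'.1 T (fun x hx => mem_erase.2 ⟨fun e => hvT (e ▸ hx), hT hx⟩) h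
    · rw [sum_nbrsIn_erase hv, hprev'.2, turanEdges_succ, hdeg]
      ring

/-! ### Counting in the Turán graph -/

theorem card_edgeFinset_turanGraph_three (n : ℕ) :
    (turanGraph n 3).edgeFinset.card = turanEdges n := by
  rw [card_edgeFinset_turanGraph]
  obtain ⟨k, rfl | rfl | rfl⟩ : ∃ k, n = 3 * k ∨ n = 3 * k + 1 ∨ n = 3 * k + 2 :=
    ⟨n / 3, by omega⟩
  · unfold turanEdges
    rw [show 3 * k / 3 = k by omega, show (3 * k + 1) / 3 = k by omega,
      show (3 * k + 2) / 3 = k by omega, show 3 * k % 3 = 0 by omega]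
    rw [show ((3 * k) ^ 2 - 0 ^ 2) * (3 - 1) = 3 * (k * k) * (2 * 3) by norm_num; ring,
      Nat.mul_div_cancel _ (by norm_num)]
    simp only [Nat.choose_zero_succ]
    ring
  · unfold turanEdges
    rw [show (3 * k + 1) / 3 = k by omega, show (3 * k + 1 + 1) / 3 = k by omega,
      show (3 * k + 1 + 2) / 3 = k + 1 by omega, show (3 * k + 1) % 3 = 1 by omega,
      show (3 * k + 1) ^ 2 = (9 * k * k + 6 * k) + 1 ^ 2 by ring, Nat.add_sub_cancel,
      show (9 * k * k + 6 * k) * (3 - 1) = (3 * k * k + 2 * k) * (2 * 3) by norm_num; ring,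
      Nat.mul_div_cancel _ (by norm_num)]
    simp
    ring
  · unfold turanEdges
    rw [show (3 * k + 2) / 3 = k by omega, show (3 * k + 2 + 1) / 3 = k + 1 by omega,
      show (3 * k + 2 + 2) / 3 = k + 1 by omega, show (3 * k + 2) % 3 = 2 by omega,
      show (3 * k + 2) ^ 2 = (9 * k * k + 12 * k) + 2 ^ 2 by ring, Nat.add_sub_cancel,
      show (9 * k * k + 12 * k) * (3 - 1) = (3 * k * k + 4 * k) * (2 * 3) by norm_num; ring,
      Nat.mul_div_cancel _ (by norm_num)]
    simp
    ring

theorem turanTriangles_le_card_cliqueFinset (n : ℕ) :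
    turanTriangles n ≤ ((turanGraph n 3).cliqueFinset 3).card := by
  -- The parts are the residue classes mod 3; a triangle takes one vertex from each.
  let f : Fin (n / 3) × Fin ((n + 1) / 3) × Fin ((n + 2) / 3) → Finset (Fin n) := fun p =>
    {⟨3 * p.1 + 2, by have := p.1.2; omega⟩, ⟨3 * p.2.1 + 1, by have := p.2.1.2; omega⟩,
      ⟨3 * p.2.2, by have := p.2.2.2; omega⟩}
  have hf : Function.Injective f := by
    rintro ⟨a, b, c⟩ ⟨a', b', c'⟩ h
    have h1 := Finset.ext_iff.1 h
    have ha := (h1 ⟨3 * a + 2, by have := a.2; omega⟩).1 (by simp [f])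
    have hb := (h1 ⟨3 * b + 1, by have := b.2; omega⟩).1 (by simp [f])
    have hc := (h1 ⟨3 * c, by have := c.2; omega⟩).1 (by simp [f])
    simp only [f, mem_insert, mem_singleton, Fin.mk.injEq] at ha hb hc
    simp only [Prod.mk.injEq, Fin.ext_iff]
    omega
  have hcard : (univ.image f).card = turanTriangles n := by
    rw [card_image_of_injective _ hf, card_univ]
    simp only [Fintype.card_prod, Fintype.card_fin, turanTriangles]
    ring
  rw [← hcard]
  refine card_le_card fun T hT => ?_
  obtain ⟨p, -, rfl⟩ := mem_image.1 hT
  rw [mem_cliqueFinset_iff, is3Clique_iff]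
  refine ⟨_, _, _, ?_, ?_, ?_, rfl⟩ <;> rw [turanGraph_adj] <;> simp only <;> omega

/-! ### Passage to the cover number -/

section CoverNumber

variable {W : Type*} [Fintype W] {H : SimpleGraph W}

theorem triangleCliqueCoverNumber_le {C : Finset (Finset W)} (h : H.IsKtCliqueCover 3 C) :
    H.triangleCliqueCoverNumber ≤ C.card :=
  Nat.sInf_le ⟨C, h, rfl⟩

theorem exists_isKtCliqueCover_card_eq (H : SimpleGraph W) :
    ∃ C, H.IsKtCliqueCover 3 C ∧ C.card = H.triangleCliqueCoverNumber := by
  obtain ⟨C, hC⟩ := H.exists_isKtCliqueCover 3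
  exact Nat.sInf_mem (s := {k | ∃ C, H.IsKtCliqueCover 3 C ∧ C.card = k}) ⟨_, C, hC, rfl⟩

theorem coversTriangles_univ_iff {C : Finset (Finset W)} :
    H.CoversTriangles univ C ↔ H.IsKtCliqueCover 3 C :=
  and_congr_right fun _ => ⟨fun h T hT => h T (subset_univ T) hT, fun h T _ hT => h T hT⟩

theorem triangleCliqueCoverNumber_le_turanTriangles (H : SimpleGraph W) :
    H.triangleCliqueCoverNumber ≤ turanTriangles (Fintype.card W) := by
  classical
  obtain ⟨C, hC, hCc⟩ := exists_coversTriangles_card_le (G := H) univ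
  exact (triangleCliqueCoverNumber_le (coversTriangles_univ_iff.1 hC)).trans hCc

/-- In a `K₄`-free graph each triangle needs a clique of its own. -/
theorem CliqueFree.card_cliqueFinset_le_triangleCliqueCoverNumber [DecidableEq W]
    [DecidableRel H.Adj] (hH : H.CliqueFree 4) :
    (H.cliqueFinset 3).card ≤ H.triangleCliqueCoverNumber := by
  obtain ⟨C, hC, hCc⟩ := exists_isKtCliqueCover_card_eq H
  rw [← hCc]
  refine card_le_card fun T hT => ?_
  rw [mem_cliqueFinset_iff] at hT
  obtain ⟨Q, hQ, hTQ⟩ := hC.2 T hT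
  have hQ3 : Q.card ≤ 3 := by
    by_contra! h
    obtain ⟨R, hRQ, hR⟩ := exists_subset_card_eq h
    exact hH R ⟨(hC.1 Q hQ).subset (coe_subset.2 hRQ), hR⟩
  rwa [eq_of_subset_of_card_le hTQ (by rw [hT.card_eq]; exact hQ3)]

theorem nonempty_iso_turanGraph_of_le (h2 : Fintype.card W ≠ 2)
    (h : turanTriangles (Fintype.card W) ≤ H.triangleCliqueCoverNumber) :
    Nonempty (H ≃g turanGraph (Fintype.card W) 3) := by
  classical
  obtain ⟨hfree, hsum⟩ := cliqueFree_and_sum_nbrsIn_of_extremal (G := H) univ h2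
    fun C hC => h.trans (triangleCliqueCoverNumber_le (coversTriangles_univ_iff.1 hC))
  have hedges : H.edgeFinset.card = turanEdges (Fintype.card W) := by
    have h1 := H.sum_degrees_eq_twice_card_edges
    have h2 : ∀ x, (H.nbrsIn univ x).card = H.degree x := fun x => by
      rw [← card_neighborFinset_eq_degree, neighborFinset_eq_filter]
      rfl
    simp only [h2] at hsum
    rw [hsum, card_univ] at h1
    omega
  -- Being `K₄`-free with the Turán number of edges makes `H` Turán-maximal.
  rw [← isTuranMaximal_iff_nonempty_iso_turanGraph (by norm_num)]
  refine ⟨fun T => hfree T (subset_univ T), fun H' _ hH' => ?_⟩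
  rw [hedges, ← card_edgeFinset_turanGraph_three, card_edgeFinset_turanGraph]
  exact hH'.card_edgeFinset_le

end CoverNumber

end SimpleGraph

theorem mainTheorem1 {V : Type*} [Fintype V] (G : SimpleGraph V) (n : ℕ)
    (hn : Fintype.card V = n) :
    G.triangleCliqueCoverNumber ≤ ((SimpleGraph.turanGraph n 3).cliqueFinset 3).card ∧
    (n ≠ 2 →
      G.triangleCliqueCoverNumber = ((SimpleGraph.turanGraph n 3).cliqueFinset 3).card →
      Nonempty (G ≃g SimpleGraph.turanGraph n 3)) ∧
    (SimpleGraph.turanGraph n 3).triangleCliqueCoverNumber =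
      ((SimpleGraph.turanGraph n 3).cliqueFinset 3).card := by
  subst hn
  have hle := SimpleGraph.turanTriangles_le_card_cliqueFinset (Fintype.card V)
  refine ⟨G.triangleCliqueCoverNumber_le_turanTriangles.trans hle, fun h2 h =>
    SimpleGraph.nonempty_iso_turanGraph_of_le h2 (by rwa [h]), le_antisymm ?_ ?_⟩
  · refine le_trans ?_ hle
    simpa using
      (SimpleGraph.turanGraph (Fintype.card V) 3).triangleCliqueCoverNumber_le_turanTriangles
  · exact (SimpleGraph.turanGraph_cliqueFree
      (by norm_num)).card_cliqueFinset_le_triangleCliqueCoverNumber
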